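/- Let $0<p<1$ and $q=1-p$. Seat $n\ge 1$ guests at a circular table with places $1,\dots,n$ and $n$ napkins, one between each two cyclically adjacent places (for $n=1$ the single napkin is both the left and the right one). The guests arrive one at a time, in a uniformly random order of the places. Independently of this order and of each other, each guest prefers the napkin on his left with probability $p$ and the napkin on his right with probability $q$. An arriving guest takes the napkin he prefers if it is still there; otherwise he takes the other adjacent napkin if it is still there (he is then called frustrated); otherwise he gets no napkin (he is then called napkinless). Let $P(i,j,n)$ be the probability that exactly $i$ guests are napkinless and exactly $j$ guests are frustrated. Encode a realization by a signed permutation $\pi$ of $[n]$: the absolute value of the $k$-th entry is the arrival time of the guest at place $k$, and its sign is $-$ if this guest prefers left and $+$ if he prefers right. Let $|\pi|_-$ and $|\pi|_+$ be the numbers of negative and positive entries, and $o(\pi)$ and $m(\pi)$ the numbers of napkinless and frustrated guests. Put $$C(x,y,z)=\sum_{n\ge1}\ \sum_{\pi} p^{|\pi|_-}q^{|\pi|_+}x^{o(\pi)}y^{m(\pi)}\,\frac{z^n}{n!}\ \in\ \mathbb{R}[x,y][[z]],$$ where the inner sum is over all signed permutations $\pi$ of $[n]$. Then for all $i,j\ge0$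 and $n\ge1$ the coefficient of $x^iy^jz^n$ in $C$ is $P(i,j,n)$ (and there are no terms with $n=0$), and $$C(x,y,z)=\frac{pqyz\big((x-y)e^{yz}+(qy^2+py-x)e^{pyz}+(py^2+qy-x)e^{qyz}+x\big)}{D},$$ where $$D=pq(y-x)e^{yz}+(qx-pqy-q^2y^2)e^{pyz}+(px-pqy-p^2y^2)e^{qyz}+pq\big(y(y-1)^2+x(1-yz)\big)+y^2-x .$$ Here the exponentials are power series in $z$ over $\mathbb{R}[x,y]$, $D$ is a nonzero element of $\mathbb{R}[x,y][[z]]$, and the identity holds in the field of fractions of $\mathbb{R}[x,y][[z]]$. -/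

import Mathlib

open MeasureTheory

namespace Napkin

/-- A signed permutation of `[n]`, with places and arrival times numbered from `0`: `π.1 i` is the
arrival time of the guest at place `i` (the absolute value of the `i`-th entry), and `π.2 i` is
`true` if this guest prefers the left napkin (negative entry), `false` if he prefers the right one
(positive entry). -/
abbrev SignedPerm (n : ℕ) : Type := Equiv.Perm (Fin n) × (Fin n → Bool)

/-- The napkin on the left of place `i` is napkin `i`. -/
def leftNapkin {n : ℕ} (i : Fin n) : Fin n := i

/-- The napkin on the right of place `i` is napkin `i + 1` modulo `n`, that is, the napkin on the
left of the next place of the circular table. -/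
def rightNapkin {n : ℕ} (i : Fin n) : Fin n := finRotate n i

/-- The napkin that the guest at place `i` prefers. -/
def preferred {n : ℕ} (π : SignedPerm n) (i : Fin n) : Fin n :=
  if π.2 i then leftNapkin i else rightNapkin i

/-- The other napkin of the guest at place `i`. -/
def other {n : ℕ} (π : SignedPerm n) (i : Fin n) : Fin n :=
  if π.2 i then rightNapkin i else leftNapkin i

/-- What the guest at place `i` takes if the napkins in `T` are gone when he arrives: the preferred
napkin if it is there, otherwise the other one if it is there, otherwise nothing. -/
def choice {n : ℕ} (π : SignedPerm n) (T : Finset (Fin n)) (i : Fin n) : Option (Fin n) :=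
  if preferred π i ∉ T then some (preferred π i)
  else if other π i ∉ T then some (other π i)
  else none

/-- The set of napkins that are taken after the first `t` guests (those with arrival times
`0, …, t - 1`) have been seated. -/
def taken {n : ℕ} (π : SignedPerm n) : ℕ → Finset (Fin n)
  | 0 => ∅
  | t + 1 =>
    if h : t < n then taken π t ∪ (choice π (taken π t) (π.1.symm ⟨t, h⟩)).toFinset
    else taken π t

/-- The napkin that the guest at place `i` ends up with, if any. -/
def napkinOf {n : ℕ} (π : SignedPerm n) (i : Fin n) : Option (Fin n) :=
  choice π (taken π (π.1 i)) i

/-- The number `o(π)` of napkinless guests. -/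
def numNapkinless {n : ℕ} (π : SignedPerm n) : ℕ :=
  (Finset.univ.filter fun i => napkinOf π i = none).card

/-- The number `m(π)` of frustrated guests: those who get a napkin, but not the one they prefer. -/
def numFrustrated {n : ℕ} (π : SignedPerm n) : ℕ :=
  (Finset.univ.filter fun i => napkinOf π i ≠ none ∧ napkinOf π i ≠ some (preferred π i)).card

/-- The number of negative entries, that is, of guests who prefer the left napkin. -/
def numNeg {n : ℕ} (π : SignedPerm n) : ℕ := (Finset.univ.filter fun i => π.2 i = true).card

/-- The number of positive entries, that is, of guests who prefer the right napkin. -/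
def numPos {n : ℕ} (π : SignedPerm n) : ℕ := (Finset.univ.filter fun i => π.2 i = false).card

/-! ### The random seating -/

instance instMeasurableSpacePerm (n : ℕ) : MeasurableSpace (Equiv.Perm (Fin n)) := ⊤

/-- The law of one guest's preference: left with probability `p`, right with probability `1 - p`. -/
noncomputable def preferenceLaw (p : ℝ) : Measure Bool :=
  ENNReal.ofReal p • Measure.dirac true + ENNReal.ofReal (1 - p) • Measure.dirac false

/-- The law of the circular napkin process for `n` guests: the order of arrival is uniformly random
and, independently of it, the preferences of the guests are independent. -/
noncomputable def seatingLaw (p : ℝ) (n : ℕ) : Measure (SignedPerm n) :=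
  (ProbabilityTheory.uniformOn (Set.univ : Set (Equiv.Perm (Fin n)))).prod
    (Measure.pi fun _ : Fin n => preferenceLaw p)

/-- The probability that at a circular table for `n` guests exactly `i` guests are napkinless and
exactly `j` guests are frustrated. -/
noncomputable def prob (p : ℝ) (i j n : ℕ) : ℝ :=
  (seatingLaw p n).real {π | numNapkinless π = i ∧ numFrustrated π = j}

/-! ### Generating functions, as power series in `z` over the polynomial ring `ℝ[x, y]` -/

/-- The polynomial ring `ℝ[x, y]`. -/
abbrev Poly : Type := MvPolynomial (Fin 2) ℝ

/-- The indeterminate `x`, which marks napkinless guests. -/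
noncomputable def polyX : Poly := MvPolynomial.X 0

/-- The indeterminate `y`, which marks frustrated guests. -/
noncomputable def polyY : Poly := MvPolynomial.X 1

/-- The coefficient of `x ^ i * y ^ j * z ^ n` in a power series in `z` over `ℝ[x, y]`. -/
noncomputable def coeffXYZ (i j n : ℕ) (F : PowerSeries Poly) : ℝ :=
  MvPolynomial.coeff (Finsupp.single 0 i + Finsupp.single 1 j) (PowerSeries.coeff n F)

/-- The weight `p ^ |π|₋ * q ^ |π|₊ * x ^ o(π) * y ^ m(π)`, where `q = 1 - p`. -/
noncomputable def weight (p : ℝ) {n : ℕ} (π : SignedPerm n) : Poly :=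
  MvPolynomial.C (p ^ numNeg π * (1 - p) ^ numPos π) *
    polyX ^ numNapkinless π * polyY ^ numFrustrated π

/-- The generating function `C(x, y, z) = ∑_{n ≥ 1} ∑_π w(π) z ^ n / n!`, where `π` runs over the
signed permutations of `[n]`. -/
noncomputable def napkinGF (p : ℝ) : PowerSeries Poly :=
  PowerSeries.mk fun n =>
    if n = 0 then 0
    else MvPolynomial.C ((1 : ℝ) / (Nat.factorial n : ℝ)) * ∑ π : SignedPerm n, weight p π

/-- The power series `x`. -/
noncomputable def serX : PowerSeries Poly := PowerSeries.C polyX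

/-- The power series `y`. -/
noncomputable def serY : PowerSeries Poly := PowerSeries.C polyY

/-- The power series `z`. -/
noncomputable def serZ : PowerSeries Poly := PowerSeries.X

/-- A real constant as a power series. -/
noncomputable def serConst (a : ℝ) : PowerSeries Poly := PowerSeries.C (MvPolynomial.C a)

/-- The power series `exp (a * y * z)`, for a real number `a`. -/
noncomputable def expYZ (a : ℝ) : PowerSeries Poly :=
  PowerSeries.rescale (MvPolynomial.C a * polyY) (PowerSeries.exp Poly)

/-- The numerator
`p q y z ((x - y) exp (y z) + (q y² + p y - x) exp (p y z) + (p y² + q y - x) exp (q y z) + x)`,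
where `q = 1 - p`. -/
noncomputable def numerC (p : ℝ) : PowerSeries Poly :=
  let P := serConst p
  let Q := serConst (1 - p)
  P * Q * serY * serZ *
    ((serX - serY) * expYZ 1
      + (Q * serY ^ 2 + P * serY - serX) * expYZ p
      + (P * serY ^ 2 + Q * serY - serX) * expYZ (1 - p)
      + serX)

/-- The denominator
`p q (y - x) exp (y z) + (q x - p q y - q² y²) exp (p y z) + (p x - p q y - p² y²) exp (q y z)
  + p q (y (y - 1)² + x (1 - y z)) + y² - x`, where `q = 1 - p`. -/
noncomputable def denomD (p : ℝ) : PowerSeries Poly :=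
  let P := serConst p
  let Q := serConst (1 - p)
  P * Q * (serY - serX) * expYZ 1
    + (Q * serX - P * Q * serY - Q ^ 2 * serY ^ 2) * expYZ p
    + (P * serX - P * Q * serY - P ^ 2 * serY ^ 2) * expYZ (1 - p)
    + P * Q * (serY * (serY - 1) ^ 2 + serX * (1 - serY * serZ))
    + serY ^ 2 - serX

end Napkin

/-!
The proof solves a system of differential equations obtained by conditioning on the first arrival.

For a set `S` of guests yet to come and a set `T` of napkins already gone, `seatSum` is the total
weight of all arrival orders and preferences of `S`, divided by `|S|!`. It satisfies a recursion on
the first arrival (`card_mul_seatSum`), and it is multiplicative over groups of guests that share no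
napkin (`seatSum_union`). Once a guest has arrived, the guests on the two sides of him share no
napkin, so a row of guests falls apart into two shorter rows, and only the presence of the two end
napkins matters. Let `F a b` (`rowSeries`) be the exponential generating function of rows whose left
end napkin is present iff `a` and whose right end napkin is present iff `b`. The recursion becomes
(`derivative_rowSeries`), with `0`, `1` for absent, present,
* `F11' = p F10 F11 + q F11 F01`,
* `F10' = p F10² + q (F11 F00 + y F10)`,
* `F01' = p (F00 F11 + y F01) + q F01²`,
* `F00' = p F00 F10 + q F01 F00 + y F00 + x`.

At the circular table the first guest leaves a row with exactly one end napkin present, so that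
`C = z (p F10 + q F01)` (`napkinGF_eq`).

The system linearizes. With `H = 1 / F11`, `U = F10 H`, `V = F01 H` and `R = F00 - F10 F01 H`,
`R' = y R + x`, `U' = q (R + y U)`, `V' = p (R + y V)`, `H' = -(p U + q V)`,
and these are solved by exponentials (`exists_rowSeries_solution`). Integrating `H'` gives
`D = p q y³ H`, whence `C D = z p q y³ (p U + q V)`, which is the numerator; in other words
`C = -z D' / D`. Since `H` has constant term `1`, `D` is not zero.

Sums over signed permutations are identified with `seatSum` by splitting a permutation into its
first value and the rest (`sum_runWeight`, `sum_weight`).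
-/

namespace Napkin

/-! ### Sums over seatings of a set of guests -/

theorem isUnit_natCast_succ (K : Type*) [CommRing K] [Algebra ℚ K] (n : ℕ) :
    IsUnit ((n + 1 : ℕ) : K) := by
  rw [show ((n + 1 : ℕ) : K) = algebraMap ℚ K (n + 1) by simp]
  exact (IsUnit.mk0 _ (by positivity)).map _

section Seating

variable {K : Type*} [CommRing K] [Algebra ℚ K] (w : Bool → K) (x y : K)
variable {G N G' N' : Type*} [DecidableEq G] [DecidableEq N] [DecidableEq G'] [DecidableEq N']

/-- The factor contributed by a guest who prefers napkin `c` to napkin `d` and arrives when the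
napkins in `T` are gone: `x` if he ends up napkinless, `y` if he is frustrated, `1` otherwise. -/
def mark (T : Finset N) (c d : N) : K :=
  if c ∉ T then 1 else if d ∉ T then y else x

/-- The set of napkins gone after the arrival of a guest who prefers napkin `c` to napkin `d`, if
`T` was that set before. -/
def nextTaken (T : Finset N) (c d : N) : Finset N :=
  if c ∉ T then insert c T else if d ∉ T then insert d T else T

/-- The napkin preferred by guest `i` if `b` says whether he prefers left. With `l` and `r`
exchanged this is his other napkin. -/
def pick (l r : G → N) (b : Bool) (i : G) : N := if b then l i else r i

/-- The normalized sum `(1 / m!) ∑ ∏ w(preference) * mark` over all arrival orders and preferences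
of the guests in `S`, starting with the napkins in `T` gone, where guest `i` has left napkin `l i`
and right napkin `r i`. It is defined by recursion on the first arrival; the number `m` is meant to
be the cardinality of `S`, so that `1 / m` is the share of each guest in the first arrivals. -/
def seatSum (l r : G → N) : ℕ → Finset G → Finset N → K
  | 0, _, _ => 1
  | m + 1, S, T => ((m + 1 : ℚ)⁻¹) • ∑ i ∈ S, ∑ b : Bool,
      w b * mark x y T (pick l r b i) (pick r l b i) *
        seatSum l r m (S.erase i) (nextTaken T (pick l r b i) (pick r l b i))

theorem card_mul_seatSum (l r : G → N) {m : ℕ} {S : Finset G} (hS : S.card = m) (T : Finset N) :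
    (m : K) * seatSum w x y l r m S T = ∑ i ∈ S, ∑ b : Bool,
      w b * mark x y T (pick l r b i) (pick r l b i) *
        seatSum w x y l r (m - 1) (S.erase i) (nextTaken T (pick l r b i) (pick r l b i)) := by
  cases m with
  | zero => simp [Finset.card_eq_zero.mp hS]
  | succ m =>
    have h : (((m : ℚ) + 1)) ≠ 0 := by positivity
    rw [seatSum, Nat.add_sub_cancel, Algebra.mul_smul_comm,
      show ((m + 1 : ℕ) : K) = algebraMap ℚ K (m + 1) by simp, ← Algebra.smul_def, smul_smul,
      inv_mul_cancel₀ h, one_smul]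

/-- Seating sums are invariant under relabelling the guests by `e` and the napkins by `g`. It is
enough that `g` is injective and respects availability on a set `A` of napkins that contains those
of all guests in `S`; napkins outside `A` play no role. -/
theorem seatSum_transport {l r : G → N} {l' r' : G' → N'} (e : G → G') (g : N → N')
    {A : Finset N} (hg : Set.InjOn g A) (m : ℕ) :
    ∀ {S : Finset G} {T : Finset N} {T' : Finset N'}, Set.InjOn e S →
      (∀ i ∈ S, l i ∈ A ∧ r i ∈ A ∧ l' (e i) = g (l i) ∧ r' (e i) = g (r i)) →
      (∀ a ∈ A, g a ∈ T' ↔ a ∈ T) →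
      seatSum w x y l' r' m (S.image e) T' = seatSum w x y l r m S T := by
  induction m with
  | zero => intros; rfl
  | succ m ih =>
    intro S T T' he hA hT
    rw [seatSum, seatSum, Finset.sum_image he]
    congr 1
    refine Finset.sum_congr rfl fun i hi => Finset.sum_congr rfl fun b _ => ?_
    obtain ⟨h1, h2, h3, h4⟩ := hA i hi
    have hc : ∀ {c}, c ∈ A → ∀ {T : Finset N} {T' : Finset N'}, (∀ a ∈ A, g a ∈ T' ↔ a ∈ T) →
        ∀ a ∈ A, g a ∈ insert (g c) T' ↔ a ∈ insert c T := by
      intro c hc T T' hT a ha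
      rw [Finset.mem_insert, Finset.mem_insert, hT a ha, hg.eq_iff ha hc]
    have key : ∀ c ∈ A, ∀ d ∈ A, mark x y T' (g c) (g d) *
          seatSum w x y l' r' m ((S.image e).erase (e i)) (nextTaken T' (g c) (g d)) =
        mark x y T c d * seatSum w x y l r m (S.erase i) (nextTaken T c d) := by
      intro c hcA d hdA
      have hS : (S.image e).erase (e i) = (S.erase i).image e := by
        ext k
        simp only [Finset.mem_erase, Finset.mem_image]
        constructor
        · rintro ⟨hk, j, hj, rfl⟩
          exact ⟨j, ⟨fun h => hk (h ▸ rfl), hj⟩, rfl⟩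
        · rintro ⟨j, ⟨hji, hj⟩, rfl⟩
          exact ⟨fun h => hji (he hj hi h), j, hj, rfl⟩
      have he' : Set.InjOn e (S.erase i) := he.mono (by simp)
      have hA' := fun j (hj : j ∈ S.erase i) => hA j (Finset.mem_of_mem_erase hj)
      rw [hS]
      simp only [mark, nextTaken, hT c hcA, hT d hdA]
      split_ifs
      · rw [ih he' hA' hT]
      · rw [ih he' hA' (hc hdA hT)]
      · rw [ih he' hA' (hc hcA hT)]
    cases b
    · simpa only [pick, Bool.false_eq_true, if_false, h3, h4, mul_assoc] using
        congrArg (w false * ·) (key _ h2 _ h1)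
    · simpa only [pick, if_true, h3, h4, mul_assoc] using
        congrArg (w true * ·) (key _ h1 _ h2)

theorem seatSum_congr_taken {l r : G → N} (m : ℕ) {S : Finset G} {T T' : Finset N}
    (h : ∀ i ∈ S, (l i ∈ T' ↔ l i ∈ T) ∧ (r i ∈ T' ↔ r i ∈ T)) :
    seatSum w x y l r m S T' = seatSum w x y l r m S T := by
  have := seatSum_transport w x y (l := l) (r := r) (l' := l) (r' := r) id id
    (A := S.image l ∪ S.image r) (Set.injOn_id _) m (S := S) (T := T) (T' := T') (Set.injOn_id _)
    (by
      intro i hi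
      simp only [Finset.mem_union, Finset.mem_image, id]
      exact ⟨.inl ⟨i, hi, rfl⟩, .inr ⟨i, hi, rfl⟩, trivial, trivial⟩)
    (by
      intro a ha
      simp only [Finset.mem_union, Finset.mem_image] at ha
      obtain ⟨i, hi, rfl⟩ | ⟨i, hi, rfl⟩ := ha
      exacts [(h i hi).1, (h i hi).2])
  simpa using this

theorem mem_nextTaken {T : Finset N} {a c d : N} (hc : a ≠ c) (hd : a ≠ d) :
    a ∈ nextTaken T c d ↔ a ∈ T := by
  unfold nextTaken; split_ifs <;> simp [hc, hd]

/-- Groups of guests that share no napkin do not interact: the seating sum is multiplicative. The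
normalization by `1 / m!` absorbs the number of ways to interleave the two arrival orders. -/
theorem seatSum_union {l r : G → N} (m : ℕ) :
    ∀ {m₁ m₂ : ℕ} {S₁ S₂ : Finset G} (T : Finset N), m₁ + m₂ = m → S₁.card = m₁ → S₂.card = m₂ →
      Disjoint S₁ S₂ →
      (∀ i ∈ S₁, ∀ j ∈ S₂, l i ≠ l j ∧ l i ≠ r j ∧ r i ≠ l j ∧ r i ≠ r j) →
      seatSum w x y l r m (S₁ ∪ S₂) T = seatSum w x y l r m₁ S₁ T * seatSum w x y l r m₂ S₂ T := by
  induction m with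
  | zero =>
    intro m₁ m₂ S₁ S₂ T hm _ _ _ _
    obtain ⟨rfl, rfl⟩ : m₁ = 0 ∧ m₂ = 0 := by omega
    simp [seatSum]
  | succ m ih =>
    intro m₁ m₂ S₁ S₂ T hm h₁ h₂ hd hne
    apply (isUnit_natCast_succ K m).mul_left_cancel
    rw [card_mul_seatSum w x y l r (by rw [Finset.card_union_of_disjoint hd, h₁, h₂, hm]) T,
      Finset.sum_union hd, ← hm, Nat.cast_add, add_mul, ← mul_assoc,
      card_mul_seatSum w x y l r h₁ T, mul_left_comm, card_mul_seatSum w x y l r h₂ T,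
      Finset.sum_mul, Finset.mul_sum]
    have hpick : ∀ b i, (pick l r b i = l i ∨ pick l r b i = r i) ∧
        (pick r l b i = l i ∨ pick r l b i = r i) := by
      intro b i; cases b <;> simp [pick]
    congr 1
    · refine Finset.sum_congr rfl fun i hi => ?_
      rw [Finset.sum_mul]
      refine Finset.sum_congr rfl fun b _ => ?_
      have hi2 : i ∉ S₂ := Finset.disjoint_left.mp hd hi
      have hpos : 0 < S₁.card := Finset.card_pos.mpr ⟨i, hi⟩
      -- The napkin taken by `i` does not belong to the other group, whose factor is unchanged.
      rw [show m₁ + m₂ - 1 = m by omega, Finset.erase_union_distrib, Finset.erase_eq_of_notMem hi2,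
        ih (m₁ := m₁ - 1) (m₂ := m₂) _ (by omega) (by rw [Finset.card_erase_of_mem hi, h₁]) h₂
          (hd.mono_left (Finset.erase_subset _ _))
          (fun j hj => hne j (Finset.mem_of_mem_erase hj)),
        seatSum_congr_taken w x y m₂ (S := S₂) (T := T)]
      · ring
      · intro j hj
        have := hne i hi j hj
        have h := hpick b i
        constructor <;> apply mem_nextTaken <;> grind
    · refine Finset.sum_congr rfl fun i hi => ?_
      rw [Finset.mul_sum]
      refine Finset.sum_congr rfl fun b _ => ?_
      have hi1 : i ∉ S₁ := Finset.disjoint_right.mp hd hi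
      have hpos : 0 < S₂.card := Finset.card_pos.mpr ⟨i, hi⟩
      rw [show m₁ + m₂ - 1 = m by omega, Finset.erase_union_distrib, Finset.erase_eq_of_notMem hi1,
        ih (m₁ := m₁) (m₂ := m₂ - 1) _ (by omega) h₁ (by rw [Finset.card_erase_of_mem hi, h₂])
          (hd.mono_right (Finset.erase_subset _ _))
          (fun j hj k hk => hne j hj k (Finset.mem_of_mem_erase hk)),
        seatSum_congr_taken w x y m₁ (S := S₁) (T := T)]
      · ring
      · intro j hj
        have := hne j hj i hi
        have h := hpick b i
        constructor <;> apply mem_nextTaken <;> grind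

end Seating

/-! ### Rows of guests -/

section Row

variable {K : Type*} [CommRing K] [Algebra ℚ K] (w : Bool → K) (x y : K)

/-- The seating sum of a row of `m` guests `0, …, m - 1` with napkins `0, …, m`, guest `i` sitting
between napkins `i` and `i + 1`. All inner napkins are present; napkin `0` is present iff `a`, and
napkin `m` is present iff `b`. For `m = 0` the value is `1` whatever `a` and `b` are. -/
def row (m : ℕ) (a b : Bool) : K :=
  seatSum w x y id Nat.succ m (Finset.range m) ((if a then ∅ else {0}) ∪ (if b then ∅ else {m}))

theorem row_zero (a b : Bool) : row w x y 0 a b = 1 := rfl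

/-- Any set of guests that sit next to each other, listed by `e` from left to right and separated
by distinct napkins listed by `g`, has the seating sum of a row. -/
theorem seatSum_eq_row {G N : Type*} [DecidableEq G] [DecidableEq N] {l r : G → N} (m : ℕ)
    (a b : Bool) {S : Finset G} {T : Finset N} (e : ℕ → G) (g : ℕ → N)
    (hg : Set.InjOn g (Finset.range (m + 1))) (hS : S = (Finset.range m).image e)
    (he : Set.InjOn e (Finset.range m))
    (hl : ∀ i < m, l (e i) = g i) (hr : ∀ i < m, r (e i) = g (i + 1))
    (hT : 0 < m → ∀ i ≤ m, g i ∈ T ↔ (i = 0 ∧ a = false) ∨ (i = m ∧ b = false)) :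
    seatSum w x y l r m S T = row w x y m a b := by
  subst hS
  rcases Nat.eq_zero_or_pos m with rfl | hm
  · rfl
  refine seatSum_transport w x y e g hg m he ?_ ?_
  · intro i hi
    have hi := Finset.mem_range.mp hi
    refine ⟨?_, ?_, hl i hi, hr i hi⟩ <;> simp <;> omega
  · intro i hi
    rw [hT hm i (by simpa [Nat.lt_succ_iff] using hi)]
    cases a <;> cases b <;> simp

/-- Without guest `k`, a row of `m + 1` guests consists of two rows, of `k` and `m - k` guests. -/
theorem seatSum_row_split {m k : ℕ} (hk : k ≤ m) (a b a' b' : Bool) {T : Finset ℕ}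
    (hT : 0 < k → ∀ i ≤ k, i ∈ T ↔ (i = 0 ∧ a = false) ∨ (i = k ∧ b' = false))
    (hT' : k < m → ∀ i, k < i → i ≤ m + 1 →
      (i ∈ T ↔ (i = k + 1 ∧ a' = false) ∨ (i = m + 1 ∧ b = false))) :
    seatSum w x y id Nat.succ m ((Finset.range (m + 1)).erase k) T =
      row w x y k a b' * row w x y (m - k) a' b := by
  have hS : (Finset.range (m + 1)).erase k = Finset.range k ∪ Finset.Ioc k m := by
    ext i; simp; omega
  rw [hS, seatSum_union w x y m (m₁ := k) (m₂ := m - k) T (by omega) (by simp) (by simp),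
    seatSum_eq_row w x y k a b' id id (Set.injOn_id _) (by simp) (Set.injOn_id _)
      (fun _ _ => rfl) (fun _ _ => rfl) hT,
    seatSum_eq_row w x y (m - k) a' b (fun i => k + 1 + i) (fun i => k + 1 + i)
      (by intro i _ j _ h; simpa using h) _ (by intro i _ j _ h; simpa using h)
      (fun _ _ => rfl) (fun _ _ => rfl)]
  · intro h i hi
    rw [hT' (by omega) _ (by omega) (by omega)]
    constructor <;> (rintro (⟨h1, h2⟩ | ⟨h1, h2⟩)) <;> [left; right; left; right] <;>
      exact ⟨by omega, h2⟩
  · ext i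
    simp only [Finset.mem_Ioc, Finset.mem_image, Finset.mem_range]
    constructor
    · intro h; exact ⟨i - (k + 1), by omega, by omega⟩
    · rintro ⟨j, hj, rfl⟩; omega
  · rw [Finset.disjoint_left]; intro i hi; simp at hi ⊢; omega
  · intro i hi j hj; simp at hi hj ⊢; omega

/-- Conditioning on the first arrival `k` in a row. The exceptional cases are those where `k` sits at
an end of the row and prefers a missing napkin: he is napkinless if he is alone and his other napkin
is missing too, and frustrated otherwise. -/
theorem row_recurrence (m : ℕ) (a b : Bool) :
    (m + 1 : K) * row w x y (m + 1) a b = ∑ k ∈ Finset.range (m + 1),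
      (w true * (if k = 0 ∧ a = false then (if m = 0 ∧ b = false then x else y * row w x y m false b)
          else row w x y k a false * row w x y (m - k) true b) +
        w false * (if k = m ∧ b = false then
          (if m = 0 ∧ a = false then x else y * row w x y m a false)
          else row w x y k a true * row w x y (m - k) false b)) := by
  have h := card_mul_seatSum w x y id Nat.succ (m := m + 1) (S := Finset.range (m + 1)) (by simp)
    ((if a then ∅ else {0}) ∪ (if b then ∅ else {m + 1}))
  rw [row, ← Nat.cast_succ, h]
  refine Finset.sum_congr rfl fun k hk => ?_
  have hk : k ≤ m := by simpa [Nat.lt_succ_iff] using hk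
  set T : Finset ℕ := (if a then ∅ else {0}) ∪ (if b then ∅ else {m + 1}) with hTdef
  have hT : ∀ i, i ∈ T ↔ (i = 0 ∧ a = false) ∨ (i = m + 1 ∧ b = false) := by
    intro i; cases a <;> cases b <;> simp [hTdef]
  rw [Fintype.sum_bool]
  simp only [pick, if_true, Bool.false_eq_true, if_false, id, mul_assoc, Nat.add_sub_cancel]
  congr 2
  · split_ifs with h1 h2
    · obtain ⟨rfl, rfl⟩ := h1
      obtain ⟨rfl, rfl⟩ := h2
      simp [mark, hT, seatSum]
    · obtain ⟨rfl, rfl⟩ := h1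
      have h0 : 0 ∈ T := by simp [hT]
      have h1 : Nat.succ 0 ∉ T := by rw [hT]; grind
      rw [mark, nextTaken, if_neg (by simpa using h0), if_pos h1, if_neg (by simpa using h0),
        if_pos h1, seatSum_row_split w x y hk true b false false (by simp), row_zero, one_mul,
        Nat.sub_zero]
      intro hm i h3 h4
      rw [Finset.mem_insert, hT]; grind
    · have h0 : k ∉ T := by rw [hT]; grind
      rw [mark, nextTaken, if_pos h0, if_pos h0, one_mul]
      apply seatSum_row_split w x y hk
      · intro _ i hi; rw [Finset.mem_insert, hT]; grind
      · intro _ i hi hi'; rw [Finset.mem_insert, hT]; grind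
  · split_ifs with h1 h2
    · obtain ⟨rfl, rfl⟩ := h1
      obtain ⟨rfl, rfl⟩ := h2
      simp [mark, hT, seatSum]
    · obtain ⟨rfl, rfl⟩ := h1
      have h0 : k.succ ∈ T := by simp [hT]
      have h1 : k ∉ T := by rw [hT]; grind
      rw [mark, nextTaken, if_neg (by simpa using h0), if_pos h1, if_neg (by simpa using h0),
        if_pos h1, seatSum_row_split w x y hk a true true false, Nat.sub_self, row_zero, mul_one]
      · intro hm i h3
        rw [Finset.mem_insert, hT]; grind
      · intro h; omega
    · have h0 : k.succ ∉ T := by rw [hT]; grind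
      rw [mark, nextTaken, if_pos h0, if_pos h0, one_mul]
      apply seatSum_row_split w x y hk
      · intro _ i hi; rw [Finset.mem_insert, hT]; grind
      · intro _ i hi hi'; rw [Finset.mem_insert, hT]; grind

/-- The exponential generating function of rows with left end napkin present iff `a` and right end
napkin present iff `b`. The constant term is `0` if both ends are missing: this encodes that the
first guest at the left end cannot take his left napkin if it is missing, the part of the row to his
left then being empty with both ends missing; similarly at the right end. In the other cases the
empty row counts `1`. -/
def rowSeries (a b : Bool) : PowerSeries K :=
  PowerSeries.mk fun m => if m = 0 ∧ a = false ∧ b = false then 0 else row w x y m a b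

open PowerSeries in
theorem derivative_rowSeries (a b : Bool) :
    d⁄dX K (rowSeries w x y a b) =
      C (w true) * (rowSeries w x y a false * rowSeries w x y true b +
        if a = false then C y * rowSeries w x y false b + (if b = false then C x else 0) else 0) +
      C (w false) * (rowSeries w x y a true * rowSeries w x y false b +
        if b = false then C y * rowSeries w x y a false + (if a = false then C x else 0) else 0) := by
  ext m
  rw [coeff_derivative, rowSeries, coeff_mk, if_neg (by simp), mul_comm, row_recurrence,
    Finset.sum_add_distrib, map_add, ← Finset.mul_sum, ← Finset.mul_sum, coeff_C_mul, coeff_C_mul]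
  congr 2
  · rw [map_add, coeff_mul, Finset.Nat.sum_antidiagonal_eq_sum_range_succ_mk]
    cases a
    · rw [Finset.sum_range_succ', Finset.sum_range_succ']
      cases b <;> by_cases hm : m = 0 <;> simp [rowSeries, row_zero, hm, coeff_C]
    · simp [rowSeries]
  · rw [map_add, coeff_mul, Finset.Nat.sum_antidiagonal_eq_sum_range_succ_mk]
    cases b
    · rw [Finset.sum_range_succ, Finset.sum_range_succ]
      have h : ∀ c, (∑ k ∈ Finset.range m, if k = m ∧ false = false then c
          else row w x y k a true * row w x y (m - k) false false) =
          ∑ k ∈ Finset.range m, coeff k (rowSeries w x y a true) *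
            coeff (m - k) (rowSeries w x y false false) := by
        intro c
        refine Finset.sum_congr rfl fun k hk => ?_
        have := Finset.mem_range.mp hk
        rw [if_neg (by omega), rowSeries, rowSeries, coeff_mk, coeff_mk, if_neg (by simp),
          if_neg (by omega)]
      rw [h]
      cases a <;> by_cases hm : m = 0 <;> simp [rowSeries, row_zero, hm, coeff_C]
    · simp [rowSeries]

end Row

/-! ### Solution of the differential equations -/

section Solve

open PowerSeries

variable {K : Type*} [CommRing K] [Algebra ℚ K] (w : Bool → K) (x y : K)

theorem derivative_rescale_exp (c : K) :
    d⁄dX K (rescale c (exp K)) = C c * rescale c (exp K) := by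
  ext n
  have h : ((n : ℚ) + 1) ≠ 0 := by positivity
  have h' : (1 / ((n + 1).factorial : ℚ)) * (n + 1) = 1 / (n.factorial : ℚ) := by
    rw [Nat.factorial_succ]; push_cast; field_simp
  rw [coeff_derivative, coeff_C_mul, coeff_rescale, coeff_rescale, coeff_exp, coeff_exp, ← h',
    map_mul, map_add, map_natCast, map_one]
  ring

/-- A solution of `F' = c F` with `F(0) = 0` vanishes. -/
theorem eq_zero_of_derivative_eq_mul {F : K⟦X⟧} {c : K} (hF : d⁄dX K F = C c * F)
    (h0 : constantCoeff F = 0) : F = 0 := by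
  ext n
  rw [map_zero]
  induction n with
  | zero => simpa using h0
  | succ n ih =>
    have h := congrArg (coeff n) hF
    rw [coeff_derivative, coeff_C_mul, ih, mul_zero] at h
    have hu : IsUnit ((n : K) + 1) := by simpa using isUnit_natCast_succ K n
    exact hu.mul_left_eq_zero.mp h

theorem constantCoeff_rowSeries {a b : Bool} (h : ¬(a = false ∧ b = false)) :
    constantCoeff (rowSeries w x y a b) = 1 := by
  rw [← coeff_zero_eq_constantCoeff_apply, rowSeries, coeff_mk, if_neg (by simpa using h), row_zero]

theorem constantCoeff_rowSeries_false_false :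
    constantCoeff (rowSeries w x y false false) = 0 := by
  rw [← coeff_zero_eq_constantCoeff_apply, rowSeries, coeff_mk, if_pos (by simp)]

/-- The inverse `H` of `F11` satisfies `H' = -H (p F10 + q F01)`, and `F10 H` and `F01 H` are explicit
combinations of exponentials, up to the factors `p y²` and `q y²` that clear denominators. -/
theorem exists_rowSeries_solution (hw : w true + w false = 1) :
    ∃ H : K⟦X⟧, constantCoeff H = 1 ∧
      d⁄dX K H = -(H * (C (w true) * rowSeries w x y true false +
        C (w false) * rowSeries w x y false true)) ∧
      C (w true * y ^ 2) * (rowSeries w x y true false * H) =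
        C (w false * (x - y)) * rescale y (exp K) +
        C (w true * y ^ 2 + w false * y - x) * rescale (w false * y) (exp K) + C (w true * x) ∧
      C (w false * y ^ 2) * (rowSeries w x y false true * H) =
        C (w true * (x - y)) * rescale y (exp K) +
        C (w false * y ^ 2 + w true * y - x) * rescale (w true * y) (exp K) + C (w false * x) := by
  have hA := derivative_rowSeries w x y true true
  have hB := derivative_rowSeries w x y true false
  have hD := derivative_rowSeries w x y false true
  have hE := derivative_rowSeries w x y false false
  have hA0 := constantCoeff_rowSeries w x y (a := true) (b := true) (by simp)
  have hB0 := constantCoeff_rowSeries w x y (a := true) (b := false) (by simp)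
  have hD0 := constantCoeff_rowSeries w x y (a := false) (b := true) (by simp)
  have hE0 := constantCoeff_rowSeries_false_false w x y
  simp only [if_true, if_false, Bool.true_eq_false, add_zero] at hA hB hD hE
  set A := rowSeries w x y true true
  set B := rowSeries w x y true false
  set D := rowSeries w x y false true
  set E := rowSeries w x y false false
  have hw' : (C (w true) + C (w false) : K⟦X⟧) = 1 := by rw [← map_add, hw, map_one]
  obtain ⟨H, hAH⟩ : ∃ H, A * H = 1 := ⟨invOfUnit A 1, mul_invOfUnit A 1 (by simpa using hA0)⟩
  have hH0 : constantCoeff H = 1 := by simpa [hA0] using congrArg constantCoeff hAH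
  have hH : d⁄dX K H = -(H * (C (w true) * B + C (w false) * D)) := by
    have h := congrArg (d⁄dX K) hAH
    rw [Derivation.leibniz, Derivation.map_one_eq_zero, hA, smul_eq_mul, smul_eq_mul] at h
    linear_combination H * h - (d⁄dX K H + H * (C (w true) * B + C (w false) * D)) * hAH
  have hE1 := derivative_rescale_exp y
  have hEP := derivative_rescale_exp (w true * y)
  have hEQ := derivative_rescale_exp (w false * y)
  have e0 : ∀ c : K, constantCoeff (rescale c (exp K)) = 1 := by
    intro c; simp [← coeff_zero_eq_constantCoeff_apply]
  have h1 := e0 y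
  have hP := e0 (w true * y)
  have hQ := e0 (w false * y)
  set E1 := rescale y (exp K)
  set EP := rescale (w true * y) (exp K)
  set EQ := rescale (w false * y) (exp K)
  -- `R = E - B * D * H` satisfies `R' = y R + x` and `R(0) = -1`.
  have hR : C y * (E - B * D * H) - ((C x - C y) * E1 - C x) = 0 := by
    apply eq_zero_of_derivative_eq_mul (c := y)
    · simp only [map_sub, Derivation.leibniz, smul_eq_mul, derivative_C, hE, hB, hD, hH, hE1]
      linear_combination (C y * C y * E + C y * C x - C y * C y * B * D * H) * hw' -
        (C y * E * (C (w true) * B + C (w false) * D)) * hAH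
    · simp [hE0, hB0, hD0, hH0, h1]
  refine ⟨H, hH0, hH, ?_, ?_⟩
  -- `U = B * H` satisfies `U' = q (R + y U)`, and `V = D * H` satisfies `V' = p (R + y V)`.
  · rw [← sub_eq_zero]
    apply eq_zero_of_derivative_eq_mul (c := w false * y)
    · simp only [map_sub, map_add, map_mul, map_pow, Derivation.leibniz, smul_eq_mul,
        derivative_C, hB, hH, hE1, hEQ, Derivation.leibniz_pow]
      simp only [nsmul_eq_mul, mul_zero, add_zero]
      linear_combination (C (w true) * C (w false) * C y) * hR +
        (C (w true) * C y ^ 2 * C (w false) * E) * hAH +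
        (C (w false) * C y * (C x - C y) * E1) * hw'
    · simp [hB0, hH0, h1, hQ]
      linear_combination -x * hw
  · rw [← sub_eq_zero]
    apply eq_zero_of_derivative_eq_mul (c := w true * y)
    · simp only [map_sub, map_add, map_mul, map_pow, Derivation.leibniz, smul_eq_mul,
        derivative_C, hD, hH, hE1, hEP, Derivation.leibniz_pow]
      simp only [nsmul_eq_mul, mul_zero, add_zero]
      linear_combination (C (w true) * C (w false) * C y) * hR +
        (C (w true) * C y ^ 2 * C (w false) * E) * hAH +
        (C (w true) * C y * (C x - C y) * E1) * hw'
    · simp [hD0, hH0, h1, hP]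
      linear_combination -x * hw

end Solve

/-! ### Sums over permutations -/

section Orders

variable {K : Type*} [CommRing K] (w : Bool → K) (x y : K)
variable {G N : Type*} [DecidableEq G] [DecidableEq N]

/-- The weight of one realization in which the guests `g 0, …, g (m - 1)` arrive in this order with
preferences `ε 0, …, ε (m - 1)`, starting with the napkins in `T` gone. -/
def runWeight (l r : G → N) : (m : ℕ) → (Fin m → G) → (Fin m → Bool) → Finset N → K
  | 0, _, _, _ => 1
  | m + 1, g, ε, T =>
    w (ε 0) * mark x y T (pick l r (ε 0) (g 0)) (pick r l (ε 0) (g 0)) *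
      runWeight l r m (fun k => g k.succ) (fun k => ε k.succ)
        (nextTaken T (pick l r (ε 0) (g 0)) (pick r l (ε 0) (g 0)))

/-- Summing over all arrival orders and preferences gives the seating sum: `decomposeFin` splits a
permutation `τ` into the first arrival `i = τ 0` and a permutation of the remaining guests, listed
as `g ∘ swap 0 i ∘ succ`. -/
theorem sum_runWeight [Algebra ℚ K] (l r : G → N) (m : ℕ) : ∀ (g : Fin m → G) (T : Finset N),
    Function.Injective g →
    ∑ τ : Equiv.Perm (Fin m), ∑ ε : Fin m → Bool, runWeight w x y l r m (fun k => g (τ k)) ε T =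
      (m.factorial : K) * seatSum w x y l r m (Finset.univ.image g) T := by
  induction m with
  | zero => intro g T _; simp [runWeight, seatSum]
  | succ m ih =>
    intro g T hg
    rw [Nat.factorial_succ, Nat.cast_mul, mul_right_comm,
      card_mul_seatSum w x y l r (by simp [Finset.card_image_of_injective _ hg]) T,
      Finset.sum_image hg.injOn, Finset.sum_mul,
      ← Equiv.Perm.decomposeFin.symm.sum_comp, Fintype.sum_prod_type]
    refine Finset.sum_congr rfl fun i _ => ?_
    have hg' : Function.Injective fun k : Fin m => g (Equiv.swap 0 i k.succ) :=
      hg.comp ((Equiv.injective _).comp (Fin.succ_injective _))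
    have himg : (Finset.univ.image g).erase (g i) =
        Finset.univ.image fun k : Fin m => g (Equiv.swap 0 i k.succ) := by
      ext a
      simp only [Finset.mem_erase, Finset.mem_image, Finset.mem_univ, true_and]
      constructor
      · rintro ⟨ha, j, rfl⟩
        have hj : Equiv.swap 0 i j ≠ 0 := by
          intro h
          apply ha
          replace h := h.trans (Equiv.swap_apply_right 0 i).symm
          simpa using congrArg g ((Equiv.swap 0 i).injective h)
        obtain ⟨k, hk⟩ := Fin.exists_succ_eq.mpr hj
        exact ⟨k, by rw [hk, Equiv.swap_apply_self]⟩
      · rintro ⟨k, rfl⟩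
        refine ⟨fun h => Fin.succ_ne_zero k ?_, _, rfl⟩
        simpa using (Equiv.swap 0 i).injective ((hg h).trans (Equiv.swap_apply_left 0 i).symm)
    calc _ = ∑ τ : Equiv.Perm (Fin m), ∑ b : Bool, ∑ ε : Fin m → Bool,
          w b * mark x y T (pick l r b (g i)) (pick r l b (g i)) *
            runWeight w x y l r m (fun k => g (Equiv.swap 0 i (τ k).succ)) ε
              (nextTaken T (pick l r b (g i)) (pick r l b (g i))) := by
          refine Finset.sum_congr rfl fun τ _ => ?_
          rw [← (Fin.consEquiv fun _ : Fin (m + 1) => Bool).sum_comp, Fintype.sum_prod_type]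
          simp [runWeight, Fin.consEquiv]
      _ = _ := by
          rw [Finset.sum_comm, Finset.sum_mul]
          refine Finset.sum_congr rfl fun b _ => ?_
          rw [himg, Nat.add_sub_cancel, mul_assoc, mul_comm (seatSum ..), ← ih _ _ hg']
          simp only [Finset.mul_sum]

end Orders

/-! ### The circular table -/

section Circle

variable {K : Type*} [CommRing K] (w : Bool → K) (x y : K)

theorem taken_succ {n : ℕ} (π : SignedPerm n) {t : ℕ} (h : t < n) :
    taken π (t + 1) = nextTaken (taken π t) (preferred π (π.1.symm ⟨t, h⟩))
      (other π (π.1.symm ⟨t, h⟩)) := by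
  rw [taken, dif_pos h, choice, nextTaken]
  split_ifs <;> simp [Finset.union_comm]

/-- The factors of the guests with arrival times `s, …, n - 1` multiply to the weight of their run
from the state at time `s`. -/
theorem prod_mark_eq_runWeight {n : ℕ} (π : SignedPerm n) (m : ℕ) : ∀ (s : ℕ) (h : s + m = n),
    ∏ k : Fin m, (w (π.2 (π.1.symm ⟨s + k, by omega⟩)) * mark x y (taken π (s + k))
      (preferred π (π.1.symm ⟨s + k, by omega⟩)) (other π (π.1.symm ⟨s + k, by omega⟩))) =
    runWeight w x y leftNapkin rightNapkin m (fun k => π.1.symm ⟨s + k, by omega⟩)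
      (fun k => π.2 (π.1.symm ⟨s + k, by omega⟩)) (taken π s) := by
  induction m with
  | zero => intros; rfl
  | succ m ih =>
    intro s h
    have ih := ih (s + 1) (by omega)
    rw [Fin.prod_univ_succ, runWeight]
    congr 1
    have e : nextTaken (taken π s)
        (pick leftNapkin rightNapkin (π.2 (π.1.symm ⟨s + (0 : Fin (m + 1)), by omega⟩))
          (π.1.symm ⟨s + (0 : Fin (m + 1)), by omega⟩))
        (pick rightNapkin leftNapkin (π.2 (π.1.symm ⟨s + (0 : Fin (m + 1)), by omega⟩))
          (π.1.symm ⟨s + (0 : Fin (m + 1)), by omega⟩)) = taken π (s + 1) :=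
      (taken_succ π (by omega)).symm
    rw [e]
    have hs : ∀ k : Fin m, s + 1 + (k : ℕ) = s + (k.succ : ℕ) := by
      intro k; rw [Fin.val_succ]; omega
    simp only [hs] at ih
    exact ih

theorem weight_eq_prod (p : ℝ) {n : ℕ} (π : SignedPerm n) :
    weight p π = ∏ i : Fin n, ((if π.2 i then MvPolynomial.C p else MvPolynomial.C (1 - p)) *
      mark polyX polyY (taken π (π.1 i)) (preferred π i) (other π i)) := by
  have h : ∀ i, mark polyX polyY (taken π (π.1 i)) (preferred π i) (other π i) =
      (if napkinOf π i = none then polyX else 1) *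
      (if napkinOf π i ≠ none ∧ napkinOf π i ≠ some (preferred π i) then polyY else 1) := by
    intro i
    rw [mark, napkinOf, choice]
    by_cases h1 : preferred π i ∈ taken π (π.1 i)
    · by_cases h2 : other π i ∈ taken π (π.1 i)
      · simp [h1, h2]
      · have : other π i ≠ preferred π i := fun h => h2 (h ▸ h1)
        simp [h1, h2, this]
    · simp [h1]
  have hw : ∀ i, (if π.2 i then MvPolynomial.C p else MvPolynomial.C (1 - p) : Poly) =
      (if π.2 i = true then MvPolynomial.C p else 1) *
        (if π.2 i = false then MvPolynomial.C (1 - p) else 1) := by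
    intro i; cases π.2 i <;> simp
  simp only [h, hw, Finset.prod_mul_distrib]
  simp only [Finset.prod_ite, Finset.prod_const]
  simp [weight, numNeg, numPos, numNapkinless, numFrustrated, mul_assoc]

/-- The weight of a preference: `p` for left, `1 - p` for right. -/
noncomputable def prefWeight (p : ℝ) (b : Bool) : Poly :=
  if b then MvPolynomial.C p else MvPolynomial.C (1 - p)

theorem weight_eq_runWeight (p : ℝ) {n : ℕ} (π : SignedPerm n) :
    weight p π = runWeight (prefWeight p) polyX polyY leftNapkin rightNapkin n
      (fun k => π.1.symm k) (fun k => π.2 (π.1.symm k)) ∅ := by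
  have h := prod_mark_eq_runWeight (prefWeight p) polyX polyY π n 0 (Nat.zero_add n)
  simp only [Nat.zero_add, Fin.eta] at h
  rw [show (∅ : Finset (Fin n)) = taken π 0 from rfl, ← h, weight_eq_prod,
    ← π.1.symm.prod_comp]
  simp [prefWeight]

theorem sum_weight (p : ℝ) (n : ℕ) :
    ∑ π : SignedPerm n, weight p π = (n.factorial : Poly) *
      seatSum (prefWeight p) polyX polyY leftNapkin rightNapkin n
        (Finset.univ : Finset (Fin n)) ∅ := by
  have h := sum_runWeight (prefWeight p) polyX polyY (leftNapkin (n := n)) rightNapkin n id ∅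
    Function.injective_id
  rw [Finset.image_id] at h
  -- `runWeight` lists guests and preferences by arrival time, a signed permutation by place: invert
  -- the permutation and reindex the preferences along it.
  rw [← h, Fintype.sum_prod_type,
    ← Equiv.sum_comp (Equiv.inv (Equiv.Perm (Fin n)) : Equiv.Perm (Fin n) ≃ Equiv.Perm (Fin n))]
  refine Finset.sum_congr rfl fun τ _ => ?_
  rw [← (Equiv.arrowCongr τ (Equiv.refl Bool)).sum_comp]
  refine Finset.sum_congr rfl fun ε _ => ?_
  rw [weight_eq_runWeight]
  simp [Equiv.Perm.inv_def]

open Fin.NatCast in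
/-- If guest `i` arrives first, the other guests form a row that starts at place `i + 1`. Its left end
is the right napkin `i + 1` of guest `i`, its right end is his left napkin `i`, and he has taken
exactly one of these. For `m = 0` they coincide, and the row is empty. -/
theorem seatSum_circle [Algebra ℚ K] (m : ℕ) :
    seatSum w x y leftNapkin rightNapkin (m + 1) (Finset.univ : Finset (Fin (m + 1))) ∅ =
      w true * row w x y m true false + w false * row w x y m false true := by
  apply (isUnit_natCast_succ K m).mul_left_cancel
  rw [card_mul_seatSum w x y leftNapkin rightNapkin (by simp) ∅]
  have key : ∀ i : Fin (m + 1), ∑ b : Bool,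
      w b * mark x y ∅ (pick leftNapkin rightNapkin b i) (pick rightNapkin leftNapkin b i) *
        seatSum w x y leftNapkin rightNapkin (m + 1 - 1) (Finset.univ.erase i)
          (nextTaken ∅ (pick leftNapkin rightNapkin b i) (pick rightNapkin leftNapkin b i)) =
      w true * row w x y m true false + w false * row w x y m false true := by
    intro i
    have hval : ∀ j, j ≤ m → ((j : Fin (m + 1)) : ℕ) = j := fun j hj =>
      Nat.mod_eq_of_lt (by omega)
    have hinj : Set.InjOn (fun j : ℕ => i + 1 + (j : Fin (m + 1))) (Finset.range (m + 1)) := by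
      intro j hj k hk h
      have hj' := hval j (by simpa [Nat.lt_succ_iff] using hj)
      have hk' := hval k (by simpa [Nat.lt_succ_iff] using hk)
      rw [← hj', ← hk', add_left_cancel h]
    have hlast : i + 1 + (m : Fin (m + 1)) = i := by
      have : ((m + 1 : ℕ) : Fin (m + 1)) = 0 := by simp
      push_cast at this
      rw [add_assoc, add_comm 1, this, add_zero]
    have hS : Finset.univ.erase i =
        (Finset.range m).image (fun j : ℕ => i + 1 + (j : Fin (m + 1))) := by
      symm
      apply Finset.eq_of_subset_of_card_le
      · intro a ha
        obtain ⟨j, hj, rfl⟩ := Finset.mem_image.mp ha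
        refine Finset.mem_erase.mpr ⟨fun h => ?_, Finset.mem_univ _⟩
        have hj := Finset.mem_range.mp hj
        have := hinj (by simp; omega) (by simp) (h.trans hlast.symm)
        omega
      · rw [Finset.card_image_of_injOn (hinj.mono (by simp)), Finset.card_erase_of_mem (by simp)]
        simp
    have hrow : ∀ (a b : Bool) (c : Fin (m + 1)),
        (0 < m → ∀ j ≤ m, i + 1 + (j : Fin (m + 1)) = c ↔
          (j = 0 ∧ a = false) ∨ (j = m ∧ b = false)) →
        seatSum w x y leftNapkin rightNapkin m (Finset.univ.erase i) {c} = row w x y m a b := by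
      intro a b c hc
      refine seatSum_eq_row w x y m a b _ _ hinj hS (hinj.mono (by simp)) (fun _ _ => rfl) ?_ ?_
      · intro j _
        simp [rightNapkin, add_assoc]
      · intro hm j hj
        rw [Finset.mem_singleton, hc hm j hj]
    have h1 := hrow true false i (by
      intro _ j hj
      constructor
      · intro h
        exact .inr ⟨hinj (by simp; omega) (by simp) (h.trans hlast.symm), rfl⟩
      · rintro (⟨_, h⟩ | ⟨rfl, -⟩)
        · cases h
        · exact hlast)
    have h2 := hrow false true (i + 1) (by
      intro _ j hj
      constructor
      · intro h
        exact .inl ⟨hinj (by simp; omega) (by simp) (h.trans (by simp)), rfl⟩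
      · rintro (⟨rfl, -⟩ | ⟨_, h⟩)
        · simp
        · cases h)
    rw [Fintype.sum_bool]
    simp [mark, nextTaken, pick, leftNapkin, rightNapkin, h1, h2]
  rw [Finset.sum_congr rfl fun i _ => key i, Finset.sum_const, Finset.card_univ, Fintype.card_fin,
    nsmul_eq_mul]

end Circle

/-! ### Coefficients as probabilities -/

instance (n : ℕ) : MeasurableSingletonClass (Equiv.Perm (Fin n)) := ⟨fun _ => trivial⟩

instance (p : ℝ) : IsFiniteMeasure (preferenceLaw p) := ⟨by simp [preferenceLaw]⟩

theorem seatingLaw_real_singleton {p : ℝ} (hp0 : 0 ≤ p) (hp1 : p ≤ 1) {n : ℕ} (π : SignedPerm n) :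
    (seatingLaw p n).real {π} =
      (1 / (n.factorial : ℝ)) * (p ^ numNeg π * (1 - p) ^ numPos π) := by
  have h1 : ∀ b, (preferenceLaw p).real {b} =
      (if b = true then p else 1) * (if b = false then 1 - p else 1) := by
    intro b
    cases b <;>
      simp [preferenceLaw, Measure.real, ENNReal.toReal_ofReal, hp0, sub_nonneg.mpr hp1]
  obtain ⟨σ, ε⟩ := π
  rw [Measure.real, seatingLaw, ← Set.singleton_prod_singleton, Measure.prod_prod,
    ← Set.univ_pi_singleton, Measure.pi_pi, ENNReal.toReal_mul, ENNReal.toReal_prod]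
  congr 1
  · rw [ProbabilityTheory.uniformOn_univ]
    simp [Fintype.card_perm]
  · change ∏ i, (preferenceLaw p).real {ε i} = _
    simp only [h1, Finset.prod_mul_distrib]
    simp [Finset.prod_ite, numNeg, numPos]

theorem coeff_weight (p : ℝ) (i j : ℕ) {n : ℕ} (π : SignedPerm n) :
    MvPolynomial.coeff (Finsupp.single 0 i + Finsupp.single 1 j) (weight p π) =
      if numNapkinless π = i ∧ numFrustrated π = j then
        p ^ numNeg π * (1 - p) ^ numPos π else 0 := by
  have h : weight p π = MvPolynomial.monomial (Finsupp.single 0 (numNapkinless π) +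
      Finsupp.single 1 (numFrustrated π)) (p ^ numNeg π * (1 - p) ^ numPos π) := by
    rw [weight, polyX, polyY, MvPolynomial.X_pow_eq_monomial, MvPolynomial.X_pow_eq_monomial,
      MvPolynomial.C_mul_monomial, MvPolynomial.monomial_mul, mul_one, mul_one]
  rw [h, MvPolynomial.coeff_monomial]
  congr 1
  rw [Finsupp.ext_iff, Fin.forall_fin_two]
  simp

theorem coeffXYZ_napkinGF {p : ℝ} (hp0 : 0 ≤ p) (hp1 : p ≤ 1) (i j : ℕ) {n : ℕ} (hn : n ≠ 0) :
    coeffXYZ i j n (napkinGF p) = prob p i j n := by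
  classical
  have : IsFiniteMeasure (seatingLaw p n) := by
    unfold seatingLaw
    infer_instance
  rw [coeffXYZ, napkinGF, PowerSeries.coeff_mk, if_neg hn, MvPolynomial.coeff_C_mul,
    MvPolynomial.coeff_sum, prob]
  have hset : {π : SignedPerm n | numNapkinless π = i ∧ numFrustrated π = j} =
      ((Finset.univ.filter fun π : SignedPerm n =>
        numNapkinless π = i ∧ numFrustrated π = j : Finset (SignedPerm n)) : Set _) := by
    ext; simp
  rw [hset, ← sum_measureReal_singleton, Finset.sum_filter, Finset.mul_sum]
  refine Finset.sum_congr rfl fun π _ => ?_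
  rw [coeff_weight, seatingLaw_real_singleton hp0 hp1]
  split_ifs <;> simp

/-! ### The closed form -/

open PowerSeries in
theorem napkinGF_eq (p : ℝ) :
    napkinGF p = PowerSeries.X * (PowerSeries.C (prefWeight p true) *
        rowSeries (prefWeight p) polyX polyY true false +
      PowerSeries.C (prefWeight p false) * rowSeries (prefWeight p) polyX polyY false true) := by
  ext1 n
  cases n with
  | zero => simp [napkinGF]
  | succ m =>
    rw [coeff_succ_X_mul, map_add, coeff_C_mul, coeff_C_mul, napkinGF, coeff_mk,
      if_neg (Nat.succ_ne_zero m), sum_weight, seatSum_circle, ← mul_assoc]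
    have h : (MvPolynomial.C (1 / ((m + 1).factorial : ℝ)) * ((m + 1).factorial : Poly)) = 1 := by
      rw [← map_natCast MvPolynomial.C, ← map_mul, one_div_mul_cancel (by positivity), map_one]
    rw [h, one_mul]
    simp [rowSeries]

open PowerSeries in
theorem exists_denomD_eq (p : ℝ) : ∃ H : PowerSeries Poly, constantCoeff H = 1 ∧
    denomD p = serConst p * serConst (1 - p) * serY ^ 3 * H ∧
    napkinGF p * denomD p = numerC p := by
  obtain ⟨H, hH0, hH, hU, hV⟩ := exists_rowSeries_solution (prefWeight p) polyX polyY
    (by simp [prefWeight])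
  have hw : (serConst p + serConst (1 - p) : PowerSeries Poly) = 1 := by
    rw [serConst, serConst, ← map_add, ← map_add, add_sub_cancel, map_one, map_one]
  have hE1 : expYZ 1 = rescale polyY (exp Poly) := by rw [expYZ, map_one, one_mul]
  have hEP : expYZ p = rescale (prefWeight p true * polyY) (exp Poly) := rfl
  have hEQ : expYZ (1 - p) = rescale (prefWeight p false * polyY) (exp Poly) := rfl
  have hP : PowerSeries.C (prefWeight p true) = serConst p := rfl
  have hQ : PowerSeries.C (prefWeight p false) = serConst (1 - p) := rfl
  have d1 := derivative_rescale_exp polyY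
  have dP := derivative_rescale_exp (prefWeight p true * polyY)
  have dQ := derivative_rescale_exp (prefWeight p false * polyY)
  have c0 : ∀ a, constantCoeff (expYZ a) = 1 := by
    intro a; simp [← coeff_zero_eq_constantCoeff_apply, expYZ]
  rw [← hE1] at hU hV d1
  rw [← hEQ] at hU dQ
  rw [← hEP] at hV dP
  have hX : PowerSeries.C polyX = serX := rfl
  have hY : PowerSeries.C polyY = serY := rfl
  simp only [map_mul, map_pow, map_add, map_sub, hP, hQ, hX, hY] at hU hV hH d1 dP dQ
  have dX : d⁄dX Poly serX = 0 := derivative_C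
  have dY : d⁄dX Poly serY = 0 := derivative_C
  have dZ : d⁄dX Poly serZ = 1 := derivative_X
  have dc : ∀ a, d⁄dX Poly (serConst a) = 0 := fun a => derivative_C
  -- Both sides have the derivative `-p q y³ (p U + q V)` and the constant term `p q y³`.
  have hD : denomD p = serConst p * serConst (1 - p) * serY ^ 3 * H := by
    apply derivative.ext
    · simp only [denomD, Derivation.leibniz, Derivation.leibniz_pow, map_add, map_sub, smul_eq_mul,
        dX, dY, dZ, dc, d1, dP, dQ, hH, Derivation.map_one_eq_zero, nsmul_eq_mul]
      linear_combination (serConst p * serConst (1 - p) * serY) * (hU + hV) +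
        (serConst p * serConst (1 - p) * serY * (serX + (serX - serY) * expYZ 1)) * hw
    · simp only [denomD, map_add, map_sub, map_mul, map_pow, c0, hH0]
      simp only [serConst, serX, serY, serZ, constantCoeff_C, constantCoeff_X, map_one, map_sub]
      ring
  refine ⟨H, hH0, hD, ?_⟩
  rw [hD, napkinGF_eq, hP, hQ, numerC]
  simp only [serZ]
  linear_combination (serConst p * serConst (1 - p) * serY * PowerSeries.X) * (hU + hV) +
    (serConst p * serConst (1 - p) * serY * PowerSeries.X *
      (serX + (serX - serY) * expYZ 1)) * hw

end Napkin

theorem mainTheorem1 (p : ℝ) (hp0 : 0 < p) (hp1 : p < 1) :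
    (∀ i j n : ℕ, 1 ≤ n → Napkin.coeffXYZ i j n (Napkin.napkinGF p) = Napkin.prob p i j n) ∧
    (∀ i j : ℕ, Napkin.coeffXYZ i j 0 (Napkin.napkinGF p) = 0) ∧
    Napkin.denomD p ≠ 0 ∧
    algebraMap (PowerSeries Napkin.Poly) (FractionRing (PowerSeries Napkin.Poly))
        (Napkin.napkinGF p) =
      algebraMap (PowerSeries Napkin.Poly) (FractionRing (PowerSeries Napkin.Poly))
          (Napkin.numerC p) /
        algebraMap (PowerSeries Napkin.Poly) (FractionRing (PowerSeries Napkin.Poly))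
          (Napkin.denomD p) := by
  obtain ⟨H, hH0, hD, hN⟩ := Napkin.exists_denomD_eq p
  have hD0 : Napkin.denomD p ≠ 0 := by
    intro h
    rw [h] at hD
    have h' := congrArg PowerSeries.constantCoeff hD
    simp only [Napkin.serConst, Napkin.serY, Napkin.polyY, map_mul, map_pow, map_zero, hH0,
      PowerSeries.constantCoeff_C, mul_one] at h'
    refine mul_ne_zero (mul_ne_zero ?_ ?_) (pow_ne_zero 3 (MvPolynomial.X_ne_zero _)) h'.symm
    · simpa using hp0.ne'
    · rw [Ne, MvPolynomial.C_eq_zero]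
      exact (sub_pos.mpr hp1).ne'
  refine ⟨fun i j n hn => Napkin.coeffXYZ_napkinGF hp0.le hp1.le i j (by omega), fun i j => ?_,
    hD0, ?_⟩
  · simp [Napkin.coeffXYZ, Napkin.napkinGF]
  · rw [eq_div_iff, ← map_mul, hN]
    simpa using hD0
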